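/- Let $E$ be a locally compact separable metric space, $m$ a $\sigma$-finite Borel measure on $E$ with full support, and let $(P_t)_{t\ge 0}$ be a strongly continuous, symmetric, sub-Markovian semigroup of bounded operators on the real Hilbert space $L^2(m)=L^2(E,m)$ with norm $\|\cdot\|$ (for example, the $L^2$-semigroup of an $m$-symmetric Borel right Markov process with state space $E$); sub-Markovian means that $0\le f\le 1$ $m$-a.e. implies $0\le P_tf\le 1$ $m$-a.e. Let $\alpha>0$ and, for $f\in L^2(m)$ and $t\ge 0$, define the Bochner integrals $$U^{\alpha}f=\int_0^\infty e^{-\alpha s}P_sf\,ds,\qquad \mathcal J^{\alpha}_tf=\int_0^\infty J_0(2\sqrt{ts})\,e^{-\alpha s}P_sf\,ds,$$ where $J_0(x)=\sum_{k\ge 0}\frac{(-1)^k}{(k!)^2}\left(\frac x2\right)^{2k}$ is the Bessel function of the first kind of order $0$. Fix $f\in L^2(m)$ and set, for $t\ge 0$ and $n\ge 0$, $$j_0(t)=U^{\alpha}f,\qquad j_{n+1}(t)=U^{\alpha}f-\int_0^tU^{\alpha}j_n(s)\,ds .$$ All these Bochner integrals exist, and for every $t>0$ the iterates $j_n(s)$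 converge to $\mathcal J^{\alpha}_sf$ in $L^2(m)$ uniformly in $s\in[0,t]$: $$\lim_{n\to\infty}\ \sup_{0\le s\le t}\|j_n(s)-\mathcal J^{\alpha}_sf\|=0 .$$ More precisely, for every $t>0$ and every $n\ge 0$, $$\sup_{0\le s\le t}\|j_n(s)-\mathcal J^{\alpha}_sf\|\le\frac{t^n}{\alpha^{n+1}\,n!}\,\|f\| .$$ -/

import Mathlib

open MeasureTheory Filter Topology

noncomputable section

/-- The Bessel function of the first kind of order `0`,
`J₀(x) = ∑ₖ (-1)ᵏ / (k!)² (x/2)²ᵏ` (the series converges absolutely for every real `x`). -/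
def besselJZero (x : ℝ) : ℝ :=
  ∑' k : ℕ, (-1 : ℝ) ^ k / (k.factorial : ℝ) ^ 2 * (x / 2) ^ (2 * k)

/-- `P` is a strongly continuous, symmetric, sub-Markovian semigroup of bounded operators on
the real Hilbert space `L²(m)`. Only the operators `P t` with `0 ≤ t` matter. -/
structure IsSymmSubMarkovSemigroup {E : Type*} [MeasurableSpace E] (m : Measure E)
    (P : ℝ → Lp ℝ 2 m →L[ℝ] Lp ℝ 2 m) : Prop where
  zero : P 0 = ContinuousLinearMap.id ℝ (Lp ℝ 2 m)
  add : ∀ s t : ℝ, 0 ≤ s → 0 ≤ t → P (s + t) = (P s).comp (P t)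
  tendsto_zero : ∀ f : Lp ℝ 2 m, Tendsto (fun t : ℝ => P t f) (𝓝[>] 0) (𝓝 f)
  symm : ∀ t : ℝ, 0 ≤ t → ∀ f g : Lp ℝ 2 m, inner ℝ (P t f) g = inner ℝ f (P t g)
  subMarkov : ∀ t : ℝ, 0 ≤ t → ∀ f : Lp ℝ 2 m,
    (∀ᵐ x ∂m, 0 ≤ f x ∧ f x ≤ 1) → ∀ᵐ x ∂m, 0 ≤ P t f x ∧ P t f x ≤ 1

section Operators

variable {E : Type*} [MeasurableSpace E] {m : Measure E}

/-- The resolvent `U^α f = ∫₀^∞ e^{-αs} P_s f ds`, a Bochner integral in `L²(m)`. -/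
def resolventOp (P : ℝ → Lp ℝ 2 m →L[ℝ] Lp ℝ 2 m) (α : ℝ) (f : Lp ℝ 2 m) : Lp ℝ 2 m :=
  ∫ s in Set.Ioi (0 : ℝ), Real.exp (-α * s) • P s f

/-- The operator `𝒥^α_t f = ∫₀^∞ J₀(2√(ts)) e^{-αs} P_s f ds`, a Bochner integral in `L²(m)`. -/
def besselOp (P : ℝ → Lp ℝ 2 m →L[ℝ] Lp ℝ 2 m) (α t : ℝ) (f : Lp ℝ 2 m) : Lp ℝ 2 m :=
  ∫ s in Set.Ioi (0 : ℝ), (besselJZero (2 * Real.sqrt (t * s)) * Real.exp (-α * s)) • P s f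

/-- The Picard iterates `j₀(t) = U^α f`, `jₙ₊₁(t) = U^α f - ∫₀ᵗ U^α jₙ(s) ds`. -/
def picardIterate (P : ℝ → Lp ℝ 2 m →L[ℝ] Lp ℝ 2 m) (α : ℝ) (f : Lp ℝ 2 m) :
    ℕ → ℝ → Lp ℝ 2 m
  | 0, _ => resolventOp P α f
  | n + 1, t => resolventOp P α f - ∫ s in (0 : ℝ)..t, resolventOp P α (picardIterate P α f n s)

end Operators

end

/-! Write `U` for the resolvent. Everything reduces to the operator identity `𝒥_t = U exp(-tU)`. The
powers of `U` are moments, `U^(k+1) f = ∫ s^k/k! e^{-αs} P_s f ds` (`resolventCLM_pow_succ_apply`),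
so integrating the Bessel series term by term gives the exponential series (`besselOp_eq`). The
Picard iterates are the Taylor polynomials of `U exp(-tU) f` (`picardIterate_eq`).

The iterates and the limit satisfy the same integral equation, so the error is integrated once per
step, gaining a factor `‖U‖ ≤ 1/α` each time (`norm_taylor_sub_exp_le`). The induction starts from
`‖f - exp(-tU) f‖ ≤ ‖f‖`, which holds because `U` is symmetric and positive.

Contractivity of `P_t` is not part of the definition; `norm_apply_le` derives it from symmetry and
the sub-Markov property. -/

/-! ### Symmetric semigroups with bounded orbits. -/

section HilbertSpace

variable {H : Type*} [NormedAddCommGroup H] [InnerProductSpace ℝ H]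

/-- If `a k ^ 2 ≤ c * a (k + 1)` along a bounded sequence of nonnegative reals,
then the sequence starts below `c`. -/
theorem le_of_sq_le_mul_succ {a : ℕ → ℝ} {c K : ℝ} (hc : 0 ≤ c)
    (hK : ∀ k, a k ≤ K) (h : ∀ k, a k ^ 2 ≤ c * a (k + 1)) : a 0 ≤ c := by
  by_contra! hlt
  rcases hc.eq_or_lt with rfl | hc
  · have := h 0
    nlinarith
  set r := a 0 / c with hr
  have hr1 : 1 < r := by rw [hr, one_lt_div hc]; exact hlt
  -- Squaring at each step makes `a k / c` grow at least like `r ^ 2 ^ k`, which is unbounded once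
  -- `r > 1`.
  have key : ∀ k, c * r ^ 2 ^ k ≤ a k := by
    intro k
    induction k with
    | zero => simp only [pow_zero, pow_one, hr]; rw [mul_div_cancel₀ _ hc.ne']
    | succ k ih =>
      have h1 : (c * r ^ 2 ^ k) ^ 2 ≤ a k ^ 2 := by gcongr
      have h2 : c * (c * r ^ 2 ^ (k + 1)) ≤ c * a (k + 1) := by
        calc c * (c * r ^ 2 ^ (k + 1)) = (c * r ^ 2 ^ k) ^ 2 := by rw [pow_succ 2 k, pow_mul]; ring
          _ ≤ _ := h1.trans (h k)
      exact le_of_mul_le_mul_left h2 hc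
  obtain ⟨k, hk⟩ := pow_unbounded_of_one_lt (K / c) hr1
  have h1 : r ^ k ≤ r ^ 2 ^ k := pow_le_pow_right₀ hr1.le Nat.lt_two_pow_self.le
  have h2 := (key k).trans (hK k)
  rw [div_lt_iff₀ hc] at hk
  nlinarith

/-- The square of the orbit of a symmetric semigroup. -/
theorem norm_sq_eq_inner_of_symm_semigroup {T : ℝ → H →L[ℝ] H}
    (hadd : ∀ s t : ℝ, 0 ≤ s → 0 ≤ t → T (s + t) = (T s).comp (T t))
    (hsymm : ∀ t : ℝ, 0 ≤ t → ∀ f g : H, inner ℝ (T t f) g = inner ℝ f (T t g))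
    {t : ℝ} (ht : 0 ≤ t) (f : H) : ‖T t f‖ ^ 2 = inner ℝ (T (t + t) f) f := by
  rw [hadd t t ht ht, ContinuousLinearMap.comp_apply, hsymm t ht, real_inner_self_eq_norm_sq]

/-- A symmetric semigroup contracts every vector whose orbit is bounded. -/
theorem norm_le_of_symm_semigroup_of_bounded {T : ℝ → H →L[ℝ] H}
    (hadd : ∀ s t : ℝ, 0 ≤ s → 0 ≤ t → T (s + t) = (T s).comp (T t))
    (hsymm : ∀ t : ℝ, 0 ≤ t → ∀ f g : H, inner ℝ (T t f) g = inner ℝ f (T t g))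
    {f : H} {K : ℝ} (hK : ∀ t : ℝ, 0 ≤ t → ‖T t f‖ ≤ K) {t : ℝ} (ht : 0 ≤ t) :
    ‖T t f‖ ≤ ‖f‖ := by
  have := le_of_sq_le_mul_succ (a := fun k => ‖T (2 ^ k * t) f‖) (c := ‖f‖) (K := K)
    (norm_nonneg _) (fun k => hK _ (by positivity)) ?_
  · simpa using this
  · intro k
    have h0 : 0 ≤ 2 ^ k * t := by positivity
    -- Time doubling with Cauchy–Schwarz: `‖T_s f‖² = ⟪T_{2s} f, f⟫ ≤ ‖f‖ ‖T_{2s} f‖`.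
    rw [norm_sq_eq_inner_of_symm_semigroup hadd hsymm h0, mul_comm ‖f‖, ← two_mul, ← mul_assoc,
      ← pow_succ']
    exact real_inner_le_norm _ _

end HilbertSpace

/-! ### Contractivity on `L²`. -/

namespace IsSymmSubMarkovSemigroup

variable {E : Type*} [MeasurableSpace E] {m : Measure E} {P : ℝ → Lp ℝ 2 m →L[ℝ] Lp ℝ 2 m}

/-- The orbit of an indicator function is bounded. -/
theorem norm_sq_indicator_le (hP : IsSymmSubMarkovSemigroup m P) {s : Set E}
    (hs : MeasurableSet s) (hms : m s ≠ ⊤) {t : ℝ} (ht : 0 ≤ t) :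
    ‖P t (indicatorConstLp 2 hs hms (1 : ℝ))‖ ^ 2 ≤ m.real s := by
  rw [norm_sq_eq_inner_of_symm_semigroup hP.add hP.symm ht, real_inner_comm,
    L2.inner_indicatorConstLp_one hs hms]
  have h01 : ∀ᵐ x ∂m, 0 ≤ indicatorConstLp 2 hs hms (1 : ℝ) x ∧
      indicatorConstLp 2 hs hms (1 : ℝ) x ≤ 1 := by
    filter_upwards [indicatorConstLp_coeFn (p := 2) (hs := hs) (hμs := hms) (c := (1 : ℝ))]
      with x hx
    rw [hx]
    by_cases h : x ∈ s <;> simp [h]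
  have h := hP.subMarkov (t + t) (by positivity) _ h01
  calc ∫ x in s, P (t + t) (indicatorConstLp 2 hs hms (1 : ℝ)) x ∂m ≤ ∫ _ in s, (1 : ℝ) ∂m := by
        apply integral_mono_of_nonneg
        · exact ae_restrict_of_ae (h.mono fun x hx => hx.1)
        · exact integrableOn_const hms
        · exact ae_restrict_of_ae (h.mono fun x hx => hx.2)
    _ = m.real s := by simp

/-- Indicators of sets of finite measure have bounded orbits, hence are contracted; the property
passes to sums of disjointly supported functions and to limits. -/
theorem norm_apply_le (hP : IsSymmSubMarkovSemigroup m P) {t : ℝ} (ht : 0 ≤ t) (f : Lp ℝ 2 m) :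
    ‖P t f‖ ≤ ‖f‖ := by
  suffices h : ∀ t : ℝ, 0 ≤ t → ‖P t f‖ ≤ ‖f‖ from h t ht
  refine Lp.induction (p := 2) (by norm_num)
    (motive := fun f : Lp ℝ 2 m => ∀ t : ℝ, 0 ≤ t → ‖P t f‖ ≤ ‖f‖) ?_ ?_ ?_ f
  · intro c s hs hms t ht
    have hc : (Lp.simpleFunc.indicatorConst 2 hs hms.ne c : Lp ℝ 2 m) =
        c • indicatorConstLp 2 hs hms.ne (1 : ℝ) := by
      rw [Lp.simpleFunc.coe_indicatorConst]
      apply Lp.ext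
      filter_upwards [indicatorConstLp_coeFn (p := 2) (hs := hs) (hμs := hms.ne) (c := c),
        indicatorConstLp_coeFn (p := 2) (hs := hs) (hμs := hms.ne) (c := (1 : ℝ)),
        Lp.coeFn_smul c (indicatorConstLp 2 hs hms.ne (1 : ℝ))] with x h1 h2 h3
      rw [h1, h3, Pi.smul_apply, h2]
      by_cases hx : x ∈ s <;> simp [hx]
    rw [hc, map_smul, norm_smul, norm_smul]
    gcongr
    refine norm_le_of_symm_semigroup_of_bounded hP.add hP.symm (K := √(m.real s)) ?_ ht
    exact fun u hu => Real.le_sqrt_of_sq_le (hP.norm_sq_indicator_le hs hms.ne hu)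
  · intro f g hf hg _ hPf hPg t ht
    -- The triangle inequality bounds the orbit only by `‖f‖ + ‖g‖`; any bound suffices, since
    -- symmetry sharpens it to `‖f + g‖`.
    refine norm_le_of_symm_semigroup_of_bounded hP.add hP.symm
      (K := ‖hf.toLp f‖ + ‖hg.toLp g‖) ?_ ht
    intro u hu
    rw [map_add]
    exact (norm_add_le _ _).trans (add_le_add (hPf u hu) (hPg u hu))
  · simp only [Set.ofPred_forall]
    exact isClosed_iInter fun t => isClosed_iInter fun _ =>
      isClosed_le (P t).continuous.norm continuous_norm

end IsSymmSubMarkovSemigroup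

/-! ### Exponentials of positive operators and their Taylor remainders. -/

section PicardExponential

variable {H : Type*} [NormedAddCommGroup H] [InnerProductSpace ℝ H] [CompleteSpace H]
  {U : H →L[ℝ] H}

open NormedSpace (exp)

theorem hasDerivAt_exp_neg_smul (U : H →L[ℝ] H) (f : H) (t : ℝ) :
    HasDerivAt (fun s : ℝ => exp ((-s) • U) f) (-(U (exp ((-t) • U) f))) t := by
  have h := (hasDerivAt_exp_smul_const' (𝕂 := ℝ) U (-t)).scomp t (hasDerivAt_neg t)
  have h2 := (ContinuousLinearMap.apply ℝ H f).hasFDerivAt.comp_hasDerivAt t h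
  simpa [Function.comp_def] using h2

/-- The exponential `exp (-tU)` of a positive operator is a contraction. -/
theorem norm_exp_neg_smul_apply_le (hpos : ∀ g, 0 ≤ inner ℝ (U g) g) {t : ℝ} (ht : 0 ≤ t)
    (f : H) : ‖exp ((-t) • U) f‖ ≤ ‖f‖ := by
  have hd : ∀ s : ℝ, HasDerivAt (fun s : ℝ => ‖exp ((-s) • U) f‖ ^ 2)
      (2 * inner ℝ (exp ((-s) • U) f) (-(U (exp ((-s) • U) f)))) s := fun s =>
    (hasDerivAt_exp_neg_smul U f s).norm_sq
  have hanti : Antitone (fun s : ℝ => ‖exp ((-s) • U) f‖ ^ 2) := by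
    apply antitone_of_deriv_nonpos (fun s => (hd s).differentiableAt)
    intro s
    rw [(hd s).deriv, inner_neg_right, real_inner_comm]
    have := hpos (exp ((-s) • U) f)
    linarith
  have h := hanti ht
  simp only [neg_zero, zero_smul, NormedSpace.exp_zero, one_apply_eq_self] at h
  exact le_of_sq_le_sq h (norm_nonneg _)

theorem inner_exp_smul_apply (hsymm : ∀ f g, inner ℝ (U f) g = inner ℝ f (U g)) (t : ℝ)
    (f g : H) : inner ℝ (exp (t • U) f) g = inner ℝ f (exp (t • U) g) := by
  have hU : IsSelfAdjoint U := ContinuousLinearMap.isSelfAdjoint_iff_isSymmetric.2 hsymm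
  have h : IsSelfAdjoint (exp (t • U)) := (IsSelfAdjoint.smul (IsSelfAdjoint.all t) hU).exp
  exact ContinuousLinearMap.isSelfAdjoint_iff_isSymmetric.1 h f g

/-- For a positive symmetric operator `U` and `t ≥ 0`, one has `0 ≤ 1 - exp (-tU) ≤ 1`. -/
theorem norm_sub_exp_neg_smul_apply_le (hsymm : ∀ f g, inner ℝ (U f) g = inner ℝ f (U g))
    (hpos : ∀ g, 0 ≤ inner ℝ (U g) g) {t : ℝ} (ht : 0 ≤ t) (f : H) :
    ‖f - exp ((-t) • U) f‖ ≤ ‖f‖ := by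
  -- With the symmetric square root `A` of `exp(-tU)`, `‖f - A²f‖² = ‖f‖² - 2‖Af‖² + ‖A²f‖²`, and
  -- `‖A²f‖ ≤ ‖Af‖`.
  set A := exp ((-(t / 2)) • U) with hA
  have hAA : exp ((-t) • U) = A * A := by
    let : NormedAlgebra ℚ (H →L[ℝ] H) := NormedAlgebra.restrictScalars ℚ ℝ _
    rw [hA, ← NormedSpace.exp_add_of_commute (Commute.refl _), ← add_smul]
    congr 2
    ring
  have hAs : ∀ f g, inner ℝ (A f) g = inner ℝ f (A g) := inner_exp_smul_apply hsymm _
  have hAn : ∀ f, ‖A f‖ ≤ ‖f‖ := norm_exp_neg_smul_apply_le hpos (by positivity)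
  rw [hAA, mul_apply_eq_comp]
  have h1 : inner ℝ f (A (A f)) = ‖A f‖ ^ 2 := by rw [← hAs, real_inner_self_eq_norm_sq]
  have h2 := hAn (A f)
  have h3 : ‖A (A f)‖ ^ 2 ≤ ‖A f‖ ^ 2 := by gcongr
  apply le_of_sq_le_sq _ (norm_nonneg _)
  rw [norm_sub_sq_real, h1]
  nlinarith [sq_nonneg ‖A f‖]

theorem integral_neg_pow_div_factorial (k : ℕ) (t : ℝ) :
    ∫ s in (0 : ℝ)..t, (-s) ^ k / (k.factorial : ℝ) =
      -((-t) ^ (k + 1) / ((k + 1).factorial : ℝ)) := by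
  rw [intervalIntegral.integral_div, intervalIntegral.integral_comp_neg (fun s => s ^ k),
    integral_pow, Nat.factorial_succ]
  push_cast
  have : (k.factorial : ℝ) ≠ 0 := by positivity
  field_simp
  simp

/-- The Picard iterates for `j(t) = U f - ∫₀ᵗ U j(s) ds` are the Taylor polynomials of
`U exp (-tU) f`. -/
theorem picard_taylor_succ (U : H →L[ℝ] H) (f : H) (n : ℕ) (t : ℝ) :
    U f - ∫ s in (0 : ℝ)..t, U (∑ k ∈ Finset.range n,
        ((-s) ^ k / (k.factorial : ℝ)) • (U ^ (k + 1)) f) =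
      ∑ k ∈ Finset.range (n + 1), ((-t) ^ k / (k.factorial : ℝ)) • (U ^ (k + 1)) f := by
  simp only [map_sum, map_smul]
  rw [intervalIntegral.integral_finsetSum]
  · simp only [intervalIntegral.integral_smul_const, integral_neg_pow_div_factorial]
    rw [Finset.sum_range_succ']
    simp only [neg_smul, Finset.sum_neg_distrib, sub_neg_eq_add, pow_zero, Nat.factorial_zero,
      Nat.cast_one, div_one, one_smul, zero_add, pow_one]
    rw [add_comm]
    congr 1
    refine Finset.sum_congr rfl fun k _ => ?_
    rw [pow_succ' U (k + 1), mul_apply_eq_comp]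
  · intro k _
    apply Continuous.intervalIntegrable
    fun_prop

/-- Error bound for the Taylor polynomials of `U exp (-tU) f`, `U` positive and symmetric. -/
theorem norm_taylor_sub_exp_le (hsymm : ∀ f g, inner ℝ (U f) g = inner ℝ f (U g))
    (hpos : ∀ g, 0 ≤ inner ℝ (U g) g) {c : ℝ} (hc : 0 ≤ c) (hU : ∀ g, ‖U g‖ ≤ c * ‖g‖)
    (f : H) (n : ℕ) {t : ℝ} (ht : 0 ≤ t) :
    ‖(∑ k ∈ Finset.range (n + 1), ((-t) ^ k / (k.factorial : ℝ)) • (U ^ (k + 1)) f) -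
        U (exp ((-t) • U) f)‖ ≤ c ^ (n + 1) * ‖f‖ * (t ^ n / (n.factorial : ℝ)) := by
  induction n generalizing t with
  | zero =>
    simp only [zero_add, Finset.range_one, Finset.sum_singleton, pow_zero, Nat.factorial_zero,
      Nat.cast_one, div_one, one_smul, pow_one, mul_one]
    rw [← map_sub]
    exact (hU _).trans (by gcongr; exact norm_sub_exp_neg_smul_apply_le hsymm hpos ht f)
  | succ n ih =>
    have hcont : Continuous fun s : ℝ => exp ((-s) • U) f :=
      continuous_iff_continuousAt.2 fun s => (hasDerivAt_exp_neg_smul U f s).continuousAt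
    have hexp : U (exp ((-t) • U) f) =
        U f - ∫ s in (0 : ℝ)..t, U (U (exp ((-s) • U) f)) := by
      have h := intervalIntegral.integral_eq_sub_of_hasDerivAt (a := 0) (b := t)
        (fun s _ => U.hasFDerivAt.comp_hasDerivAt s (hasDerivAt_exp_neg_smul U f s))
        (Continuous.intervalIntegrable (by fun_prop) _ _)
      simp only [map_neg, intervalIntegral.integral_neg, Function.comp_apply, neg_zero, zero_smul,
        NormedSpace.exp_zero, one_apply_eq_self] at h
      rw [sub_eq_add_neg, h]
      abel
    -- Subtracting the two integral equations cancels `U f` and leaves the integral of `U` applied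
    -- to the previous error.
    rw [← picard_taylor_succ, hexp, sub_sub_sub_cancel_left, ← intervalIntegral.integral_sub
      (Continuous.intervalIntegrable (by fun_prop) _ _)
      (Continuous.intervalIntegrable (by fun_prop) _ _)]
    calc _ ≤ ∫ s in (0 : ℝ)..t, c ^ (n + 2) * ‖f‖ * (s ^ n / (n.factorial : ℝ)) := by
          apply intervalIntegral.norm_integral_le_of_norm_le ht _
            (Continuous.intervalIntegrable (by fun_prop) _ _)
          refine ae_of_all _ fun s hs => ?_
          rw [← map_sub, ← norm_neg, ← map_neg, neg_sub]
          refine (hU _).trans ?_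
          calc _ ≤ c * (c ^ (n + 1) * ‖f‖ * (s ^ n / (n.factorial : ℝ))) := by
                gcongr
                exact ih hs.1.le
            _ = _ := by ring
      _ = _ := by
          rw [intervalIntegral.integral_const_mul, intervalIntegral.integral_div, integral_pow,
            Nat.factorial_succ]
          push_cast
          have : (n.factorial : ℝ) ≠ 0 := by positivity
          field_simp
          simp

end PicardExponential

/-! ### Scalar integrals and series. -/

theorem integrableOn_pow_mul_exp_neg_mul (k : ℕ) {α : ℝ} (hα : 0 < α) :
    IntegrableOn (fun s : ℝ => s ^ k * Real.exp (-α * s)) (Set.Ioi 0) := by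
  have h := integrableOn_rpow_mul_exp_neg_mul_rpow (p := 1) (s := k) (b := α)
    (by have : (0 : ℝ) ≤ k := by positivity
        linarith) one_pos hα
  simpa using h

theorem tendsto_pow_mul_exp_neg_mul_atTop (k : ℕ) {α : ℝ} (hα : 0 < α) :
    Tendsto (fun s : ℝ => s ^ k * Real.exp (-α * s)) atTop (𝓝 0) := by
  simpa using tendsto_rpow_mul_exp_neg_mul_atTop_nhds_zero k α hα

theorem hasSum_pow_div_factorial (x : ℝ) :
    HasSum (fun k : ℕ => x ^ k / (k.factorial : ℝ)) (Real.exp x) := by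
  rw [Real.exp_eq_exp_ℝ]
  exact NormedSpace.expSeries_div_hasSum_exp x

/-! ### Continuity of orbits, the resolvent and its powers. -/

namespace IsSymmSubMarkovSemigroup

variable {E : Type*} [MeasurableSpace E] {m : Measure E} {P : ℝ → Lp ℝ 2 m →L[ℝ] Lp ℝ 2 m}

/-- Nothing is known about `P r` for `r < 0`; the even extension `P |r|` allows two-sided limits and
derivatives at `0`. -/
theorem tendsto_apply_abs (hP : IsSymmSubMarkovSemigroup m P) (f : Lp ℝ 2 m) :
    Tendsto (fun r : ℝ => P |r| f) (𝓝 0) (𝓝 f) := by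
  have h1 : ContinuousWithinAt (fun r : ℝ => P r f) (Set.Ioi 0) 0 := by
    simpa [ContinuousWithinAt, hP.zero] using hP.tendsto_zero f
  rw [continuousWithinAt_Ioi_iff_Ici] at h1
  have h2 : Tendsto (fun r : ℝ => |r|) (𝓝 0) (𝓝[≥] 0) := by
    refine tendsto_nhdsWithin_iff.2 ⟨?_, Eventually.of_forall fun r => abs_nonneg r⟩
    simpa using (continuous_abs (G := ℝ)).tendsto 0
  simpa [hP.zero, Function.comp_def] using Tendsto.comp h1 h2

theorem norm_apply_sub_apply_le (hP : IsSymmSubMarkovSemigroup m P) (f : Lp ℝ 2 m) {s t : ℝ}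
    (hs : 0 ≤ s) (ht : 0 ≤ t) : ‖P s f - P t f‖ ≤ ‖P |s - t| f - f‖ := by
  wlog h : t ≤ s generalizing s t
  · rw [norm_sub_rev, abs_sub_comm]
    exact this ht hs (le_of_not_ge h)
  rw [abs_of_nonneg (sub_nonneg.2 h)]
  have h1 : P s f = P t (P (s - t) f) := by
    rw [← ContinuousLinearMap.comp_apply, ← hP.add t (s - t) ht (sub_nonneg.2 h),
      add_sub_cancel]
  rw [h1, ← map_sub]
  exact hP.norm_apply_le ht _

theorem continuous_apply_abs (hP : IsSymmSubMarkovSemigroup m P) (f : Lp ℝ 2 m) :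
    Continuous fun s : ℝ => P |s| f := by
  rw [continuous_iff_continuousAt]
  intro t
  have h1 : Tendsto (fun s : ℝ => |s| - |t|) (𝓝 t) (𝓝 0) := by
    have : Continuous fun s : ℝ => |s| - |t| := by fun_prop
    simpa using this.tendsto t
  have h2 := (((hP.tendsto_apply_abs f).comp h1).sub_const f).norm
  rw [sub_self, norm_zero] at h2
  exact tendsto_iff_norm_sub_tendsto_zero.2 (squeeze_zero (fun _ => norm_nonneg _)
    (fun s => hP.norm_apply_sub_apply_le f (abs_nonneg s) (abs_nonneg t)) h2)

theorem continuousOn_apply (hP : IsSymmSubMarkovSemigroup m P) (f : Lp ℝ 2 m) :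
    ContinuousOn (fun s : ℝ => P s f) (Set.Ici 0) :=
  (hP.continuous_apply_abs f).continuousOn.congr fun s hs => by
    simp only [abs_of_nonneg (Set.mem_Ici.1 hs)]

theorem aestronglyMeasurable_apply (hP : IsSymmSubMarkovSemigroup m P) (f : Lp ℝ 2 m) :
    AEStronglyMeasurable (fun s : ℝ => P s f) (volume.restrict (Set.Ioi 0)) :=
  ((hP.continuousOn_apply f).mono Set.Ioi_subset_Ici_self).aestronglyMeasurable measurableSet_Ioi

theorem integrableOn_smul_apply (hP : IsSymmSubMarkovSemigroup m P) {w : ℝ → ℝ}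
    (hw : IntegrableOn w (Set.Ioi 0)) (f : Lp ℝ 2 m) :
    IntegrableOn (fun s : ℝ => w s • P s f) (Set.Ioi 0) := by
  refine Integrable.mono' (hw.norm.mul_const ‖f‖)
    (hw.aestronglyMeasurable.smul (hP.aestronglyMeasurable_apply f)) ?_
  refine (ae_restrict_iff' measurableSet_Ioi).2 (ae_of_all _ fun s hs => ?_)
  rw [norm_smul]
  gcongr
  exact hP.norm_apply_le (Set.mem_Ioi.1 hs).le f

theorem integrableOn_exp_smul_apply (hP : IsSymmSubMarkovSemigroup m P) {α : ℝ} (hα : 0 < α)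
    (f : Lp ℝ 2 m) : IntegrableOn (fun s : ℝ => Real.exp (-α * s) • P s f) (Set.Ioi 0) :=
  hP.integrableOn_smul_apply (integrableOn_exp_mul_Ioi (neg_lt_zero.2 hα) 0) f

theorem norm_resolventOp_le (hP : IsSymmSubMarkovSemigroup m P) {α : ℝ} (hα : 0 < α)
    (f : Lp ℝ 2 m) : ‖resolventOp P α f‖ ≤ α⁻¹ * ‖f‖ := by
  have hint := integrableOn_exp_mul_Ioi (neg_lt_zero.2 hα) 0
  calc ‖resolventOp P α f‖ ≤ ∫ s in Set.Ioi (0 : ℝ), Real.exp (-α * s) * ‖f‖ := by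
        refine norm_integral_le_of_norm_le (hint.mul_const _) ?_
        refine (ae_restrict_iff' measurableSet_Ioi).2 (ae_of_all _ fun s hs => ?_)
        rw [norm_smul, Real.norm_eq_abs, Real.abs_exp]
        gcongr
        exact hP.norm_apply_le (Set.mem_Ioi.1 hs).le f
    _ = α⁻¹ * ‖f‖ := by
        rw [integral_mul_const, integral_exp_mul_Ioi (neg_lt_zero.2 hα)]
        simp

/-- The resolvent as a bounded operator. -/
noncomputable def resolventCLM (hP : IsSymmSubMarkovSemigroup m P) {α : ℝ} (hα : 0 < α) :
    Lp ℝ 2 m →L[ℝ] Lp ℝ 2 m :=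
  LinearMap.mkContinuous
    { toFun := resolventOp P α
      map_add' := fun f g => by
        simp only [resolventOp, map_add, smul_add]
        exact integral_add (hP.integrableOn_exp_smul_apply hα f)
          (hP.integrableOn_exp_smul_apply hα g)
      map_smul' := fun c f => by
        simp only [resolventOp, map_smul, RingHom.id_apply, smul_comm _ c]
        exact integral_smul c _ } α⁻¹ (hP.norm_resolventOp_le hα)

theorem resolventCLM_apply (hP : IsSymmSubMarkovSemigroup m P) {α : ℝ} (hα : 0 < α)
    (f : Lp ℝ 2 m) : hP.resolventCLM hα f = resolventOp P α f := rfl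

theorem inner_resolventCLM (hP : IsSymmSubMarkovSemigroup m P) {α : ℝ} (hα : 0 < α)
    (f g : Lp ℝ 2 m) : inner ℝ (hP.resolventCLM hα f) g =
      ∫ s in Set.Ioi (0 : ℝ), Real.exp (-α * s) * inner ℝ (P s f) g := by
  rw [real_inner_comm, resolventCLM_apply, resolventOp,
    ← integral_inner (hP.integrableOn_exp_smul_apply hα f)]
  simp only [real_inner_smul_right, real_inner_comm g]

theorem resolventCLM_symm (hP : IsSymmSubMarkovSemigroup m P) {α : ℝ} (hα : 0 < α)
    (f g : Lp ℝ 2 m) :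
    inner ℝ (hP.resolventCLM hα f) g = inner ℝ f (hP.resolventCLM hα g) := by
  rw [real_inner_comm (hP.resolventCLM hα g), inner_resolventCLM, inner_resolventCLM]
  refine setIntegral_congr_fun measurableSet_Ioi fun s hs => ?_
  rw [hP.symm s (Set.mem_Ioi.1 hs).le, real_inner_comm]

/-- The integrand is nonnegative because `⟪P_s f, f⟫ = ‖P_{s/2} f‖²`. -/
theorem resolventCLM_nonneg (hP : IsSymmSubMarkovSemigroup m P) {α : ℝ} (hα : 0 < α)
    (f : Lp ℝ 2 m) : 0 ≤ inner ℝ (hP.resolventCLM hα f) f := by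
  rw [inner_resolventCLM]
  refine setIntegral_nonneg measurableSet_Ioi fun s hs => ?_
  have h := norm_sq_eq_inner_of_symm_semigroup hP.add hP.symm
    (half_pos (Set.mem_Ioi.1 hs)).le f
  rw [add_halves] at h
  rw [← h]
  positivity

/-- `e^{-αs} U^α P_s f` is the tail of the integral defining `U^α f`. -/
theorem exp_smul_resolventCLM_apply (hP : IsSymmSubMarkovSemigroup m P) {α : ℝ} (hα : 0 < α)
    (f : Lp ℝ 2 m) {s : ℝ} (hs : 0 ≤ s) :
    Real.exp (-α * s) • hP.resolventCLM hα (P s f) =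
      hP.resolventCLM hα f - ∫ u in (0 : ℝ)..s, Real.exp (-α * u) • P |u| f := by
  have h1 : ∫ u in (0 : ℝ)..s, Real.exp (-α * u) • P |u| f =
      ∫ u in (0 : ℝ)..s, Real.exp (-α * u) • P u f := by
    refine intervalIntegral.integral_congr fun u hu => ?_
    rw [Set.uIcc_of_le hs] at hu
    simp only [abs_of_nonneg hu.1]
  rw [h1, ← intervalIntegral.integral_Ioi_sub_Ioi (hP.integrableOn_exp_smul_apply hα f) hs,
    resolventCLM_apply, resolventCLM_apply, resolventOp, resolventOp, sub_sub_cancel]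
  have h2 := (measurePreserving_add_right volume s).setIntegral_preimage_emb
    (measurableEmbedding_addRight s) (fun u : ℝ => Real.exp (-α * u) • P u f) (Set.Ioi s)
  rw [← h2, ← integral_smul]
  have h3 : (fun x : ℝ => x + s) ⁻¹' Set.Ioi s = Set.Ioi 0 := by
    ext x
    simp
  rw [h3]
  refine setIntegral_congr_fun measurableSet_Ioi fun u hu => ?_
  rw [hP.add u s (Set.mem_Ioi.1 hu).le hs, smul_smul, ← Real.exp_add,
    ContinuousLinearMap.comp_apply]
  congr 2
  ring

/-- The powers of the resolvent are the moments of `e^{-αs} P_s f ds`. -/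
theorem resolventCLM_pow_succ_apply (hP : IsSymmSubMarkovSemigroup m P) {α : ℝ} (hα : 0 < α)
    (f : Lp ℝ 2 m) (k : ℕ) :
    (hP.resolventCLM hα ^ (k + 1)) f =
      ∫ s in Set.Ioi (0 : ℝ), (s ^ k / (k.factorial : ℝ) * Real.exp (-α * s)) • P s f := by
  have hw (k : ℕ) : IntegrableOn (fun s : ℝ => s ^ k / (k.factorial : ℝ) * Real.exp (-α * s))
      (Set.Ioi 0) := by
    simp only [div_mul_eq_mul_div]
    exact (integrableOn_pow_mul_exp_neg_mul k hα).div_const (k.factorial : ℝ)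
  induction k with
  | zero => simp [resolventCLM_apply, resolventOp]
  | succ k ih =>
    set U := hP.resolventCLM hα with hU
    rw [pow_succ' U (k + 1), mul_apply_eq_comp, ih,
      ← ContinuousLinearMap.integral_comp_comm U (hP.integrableOn_smul_apply (hw k) f)]
    simp only [map_smul]
    -- Integration by parts of `s^k/k!` against `W`, which equals `e^{-αs} U P_s f` for `s ≥ 0` and
    -- is differentiable on all of `ℝ`; the boundary terms at `0` and `∞` vanish.
    set W : ℝ → Lp ℝ 2 m := fun s => U f - ∫ u in (0 : ℝ)..s, Real.exp (-α * u) • P |u| f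
      with hW
    have hg : Continuous fun u : ℝ => Real.exp (-α * u) • P |u| f :=
      Continuous.smul (f := fun u : ℝ => Real.exp (-α * u)) (by fun_prop) (hP.continuous_apply_abs f)
    have hWd (s : ℝ) : HasDerivAt W (-(Real.exp (-α * s) • P |s| f)) s :=
      (intervalIntegral.integral_hasDerivAt_right (hg.intervalIntegrable _ _)
        hg.stronglyMeasurable.stronglyMeasurableAtFilter hg.continuousAt).const_sub _
    have hWs {s : ℝ} (hs : 0 ≤ s) : Real.exp (-α * s) • U (P s f) = W s :=
      hP.exp_smul_resolventCLM_apply hα f hs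
    have hd (s : ℝ) : HasDerivAt (fun s : ℝ => (s ^ (k + 1) / ((k + 1).factorial : ℝ)) • W s)
        ((s ^ (k + 1) / ((k + 1).factorial : ℝ)) • (-(Real.exp (-α * s) • P |s| f)) +
          (s ^ k / (k.factorial : ℝ)) • W s) s := by
      have hp : HasDerivAt (fun s : ℝ => s ^ (k + 1) / ((k + 1).factorial : ℝ))
          (s ^ k / (k.factorial : ℝ)) s := by
        convert! (hasDerivAt_pow (k + 1) s).div_const ((k + 1).factorial : ℝ) using 1
        rw [Nat.factorial_succ]
        push_cast
        field_simp
      exact hp.smul (hWd s)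
    have hd' (s : ℝ) (hs : s ∈ Set.Ioi (0 : ℝ)) :
        HasDerivAt (fun s : ℝ => (s ^ (k + 1) / ((k + 1).factorial : ℝ)) • W s)
        ((s ^ k / (k.factorial : ℝ) * Real.exp (-α * s)) • U (P s f) -
          (s ^ (k + 1) / ((k + 1).factorial : ℝ) * Real.exp (-α * s)) • P s f) s := by
      have hs' : 0 ≤ s := (Set.mem_Ioi.1 hs).le
      convert! hd s using 1
      rw [← hWs hs', abs_of_nonneg hs', smul_neg, smul_smul, smul_smul]
      abel
    have hi1 : IntegrableOn (fun s : ℝ => (s ^ k / (k.factorial : ℝ) * Real.exp (-α * s)) •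
        U (P s f)) (Set.Ioi 0) := by
      simp only [← map_smul U]
      exact U.integrable_comp (hP.integrableOn_smul_apply (hw k) f)
    have hi2 := hP.integrableOn_smul_apply (hw (k + 1)) f
    have hlim : Tendsto (fun s : ℝ => (s ^ (k + 1) / ((k + 1).factorial : ℝ)) • W s) atTop
        (𝓝 0) := by
      have h0 : Tendsto (fun s : ℝ => s ^ (k + 1) * Real.exp (-α * s) *
          (((k + 1).factorial : ℝ)⁻¹ * (α⁻¹ * ‖f‖))) atTop (𝓝 0) := by
        simpa using (tendsto_pow_mul_exp_neg_mul_atTop (k + 1) hα).mul_const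
          (((k + 1).factorial : ℝ)⁻¹ * (α⁻¹ * ‖f‖))
      refine squeeze_zero_norm' ?_ h0
      filter_upwards [eventually_ge_atTop 0] with s hs
      rw [← hWs hs, smul_smul, norm_smul, Real.norm_of_nonneg (by positivity)]
      calc _ ≤ s ^ (k + 1) / ((k + 1).factorial : ℝ) * Real.exp (-α * s) * (α⁻¹ * ‖f‖) := by
            gcongr
            refine (hP.norm_resolventOp_le hα _).trans ?_
            gcongr
            exact hP.norm_apply_le hs f
        _ = _ := by ring
    have h := integral_Ioi_of_hasDerivAt_of_tendsto (hd 0).continuousAt.continuousWithinAt hd'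
      (hi1.sub hi2) hlim
    rw [integral_sub hi1 hi2] at h
    simpa [sub_eq_zero] using h

end IsSymmSubMarkovSemigroup

/-! ### The Bessel series and its termwise integration. -/

theorem hasSum_besselJZero {t s : ℝ} (hts : 0 ≤ t * s) :
    HasSum (fun k : ℕ => (-t) ^ k / (k.factorial : ℝ) * (s ^ k / (k.factorial : ℝ)))
      (besselJZero (2 * √(t * s))) := by
  have hterm (k : ℕ) : (-1 : ℝ) ^ k / (k.factorial : ℝ) ^ 2 * (2 * √(t * s) / 2) ^ (2 * k) =
      (-t) ^ k / (k.factorial : ℝ) * (s ^ k / (k.factorial : ℝ)) := by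
    rw [mul_div_cancel_left₀ _ (two_ne_zero), pow_mul, Real.sq_sqrt hts, mul_pow, neg_pow t]
    ring
  rw [besselJZero]
  simp only [hterm]
  refine Summable.hasSum (.of_norm_bounded (hasSum_pow_div_factorial (t * s)).summable fun k => ?_)
  have h1 : (1 : ℝ) ≤ (k.factorial : ℝ) := by exact_mod_cast k.factorial_pos
  rw [norm_mul, norm_div, norm_div, norm_pow, norm_pow, norm_neg, Real.norm_natCast,
    ← abs_of_nonneg hts, abs_mul, mul_pow, Real.norm_eq_abs, Real.norm_eq_abs, mul_div_assoc]
  gcongr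
  exact div_le_self (by positivity) h1

namespace IsSymmSubMarkovSemigroup

variable {E : Type*} [MeasurableSpace E] {m : Measure E} {P : ℝ → Lp ℝ 2 m →L[ℝ] Lp ℝ 2 m}

/-- The integral defining `𝒥^α_t f` exists and may be computed term by term. -/
theorem integrableOn_and_hasSum_besselOp (hP : IsSymmSubMarkovSemigroup m P) {α : ℝ}
    (hα : 0 < α) {t : ℝ} (ht : 0 ≤ t) (f : Lp ℝ 2 m) :
    IntegrableOn (fun s : ℝ => (besselJZero (2 * √(t * s)) * Real.exp (-α * s)) • P s f)
      (Set.Ioi 0) ∧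
    HasSum (fun k : ℕ => ((-t) ^ k / (k.factorial : ℝ)) • (hP.resolventCLM hα ^ (k + 1)) f)
      (besselOp P α t f) := by
  set F : ℕ → ℝ → Lp ℝ 2 m := fun k s =>
    ((-t) ^ k / (k.factorial : ℝ)) • ((s ^ k / (k.factorial : ℝ) * Real.exp (-α * s)) • P s f)
    with hF
  -- Split `(ts)^k = (αs/2)^k (2t/α)^k`. With one factorial the first factor sums to `e^{αs/2}`,
  -- which `e^{-αs}` absorbs; with the other the second is at most `e^{2t/α}`.
  set bound : ℕ → ℝ → ℝ := fun k s => (α / 2 * s) ^ k / (k.factorial : ℝ) *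
    (Real.exp (2 * t / α) * Real.exp (-α * s) * ‖f‖) with hbound
  have hbound_sum (s : ℝ) : HasSum (fun k => bound k s)
      (Real.exp (-(α / 2) * s) * (Real.exp (2 * t / α) * ‖f‖)) := by
    convert! (hasSum_pow_div_factorial (α / 2 * s)).mul_right
      (Real.exp (2 * t / α) * Real.exp (-α * s) * ‖f‖) using 1
    rw [show -(α / 2) * s = α / 2 * s + -α * s by ring, Real.exp_add]
    ring
  have hbound_int : IntegrableOn
      (fun s : ℝ => Real.exp (-(α / 2) * s) * (Real.exp (2 * t / α) * ‖f‖)) (Set.Ioi 0) :=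
    (integrableOn_exp_mul_Ioi (neg_lt_zero.2 (half_pos hα)) 0).mul_const _
  have hF_le (k : ℕ) {s : ℝ} (hs : 0 ≤ s) : ‖F k s‖ ≤ bound k s := by
    rw [hF]
    simp only
    rw [norm_smul, norm_smul, norm_div, norm_pow, norm_neg, Real.norm_natCast,
      Real.norm_of_nonneg ht, Real.norm_of_nonneg (by positivity)]
    calc _ ≤ t ^ k / (k.factorial : ℝ) *
          (s ^ k / (k.factorial : ℝ) * Real.exp (-α * s) * ‖f‖) := by
          gcongr
          exact hP.norm_apply_le hs f
      _ = (α / 2 * s) ^ k / (k.factorial : ℝ) *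
          ((2 * t / α) ^ k / (k.factorial : ℝ) * Real.exp (-α * s) * ‖f‖) := by
          have : (α / 2) ^ k * (2 * t / α) ^ k = t ^ k := by
            rw [← mul_pow]
            congr 1
            field_simp
          rw [← this]
          ring
      _ ≤ _ := by
          rw [hbound]
          simp only
          gcongr
          exact Real.pow_div_factorial_le_exp _ (by positivity) k
  have hF_sum {s : ℝ} (hs : 0 ≤ s) : HasSum (fun k => F k s)
      ((besselJZero (2 * √(t * s)) * Real.exp (-α * s)) • P s f) := by
    convert! ((hasSum_besselJZero (mul_nonneg ht hs)).mul_right (Real.exp (-α * s))).smul_const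
      (P s f) using 1
    ext1 k
    rw [hF]
    simp only
    rw [smul_smul, mul_assoc]
  have hF_meas (k : ℕ) : AEStronglyMeasurable (F k) (volume.restrict (Set.Ioi 0)) := by
    have hc : Continuous fun s : ℝ => s ^ k / (k.factorial : ℝ) * Real.exp (-α * s) := by
      fun_prop
    exact (hc.aestronglyMeasurable.smul (hP.aestronglyMeasurable_apply f)).const_smul
      ((-t) ^ k / (k.factorial : ℝ))
  have hF_sum_ae : ∀ᵐ s ∂volume.restrict (Set.Ioi (0 : ℝ)), HasSum (fun k => F k s)
      ((besselJZero (2 * √(t * s)) * Real.exp (-α * s)) • P s f) :=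
    (ae_restrict_iff' measurableSet_Ioi).2 (ae_of_all _ fun s hs => hF_sum (Set.mem_Ioi.1 hs).le)
  constructor
  · refine Integrable.mono' hbound_int (aestronglyMeasurable_of_tendsto_ae atTop
      (fun n => Finset.aestronglyMeasurable_fun_sum (Finset.range n) fun k _ => hF_meas k)
      (hF_sum_ae.mono fun s hs => hs.tendsto_sum_nat)) ?_
    refine (ae_restrict_iff' measurableSet_Ioi).2 (ae_of_all _ fun s hs => ?_)
    have hs' := (Set.mem_Ioi.1 hs).le
    rw [← (hF_sum hs').tsum_eq]
    exact tsum_of_norm_bounded (hbound_sum s) fun k => hF_le k hs'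
  · have h := hasSum_integral_of_dominated_convergence bound hF_meas
      (fun k => (ae_restrict_iff' measurableSet_Ioi).2
        (ae_of_all _ fun s hs => hF_le k (Set.mem_Ioi.1 hs).le))
      (ae_of_all _ fun s => (hbound_sum s).summable)
      (by simp only [(hbound_sum _).tsum_eq]; exact hbound_int) hF_sum_ae
    simp only [hF, integral_smul, ← hP.resolventCLM_pow_succ_apply hα] at h
    exact h

/-- `𝒥^α_t = U^α exp (-t U^α)`. -/
theorem besselOp_eq (hP : IsSymmSubMarkovSemigroup m P) {α : ℝ} (hα : 0 < α) {t : ℝ}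
    (ht : 0 ≤ t) (f : Lp ℝ 2 m) : besselOp P α t f =
      hP.resolventCLM hα (NormedSpace.exp ((-t) • hP.resolventCLM hα) f) := by
  refine (hP.integrableOn_and_hasSum_besselOp hα ht f).2.unique ?_
  set U := hP.resolventCLM hα
  have h := NormedSpace.exp_series_hasSum_exp' (𝕂 := ℝ) ((-t) • U)
  have h2 := (h.mapL (ContinuousLinearMap.apply ℝ (Lp ℝ 2 m) f)).mapL U
  convert! h2 using 1
  ext1 k
  simp only [ContinuousLinearMap.apply_apply, map_smul, smul_pow,
    smul_smul]
  rw [pow_succ' U k, mul_apply_eq_comp, div_eq_inv_mul]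

theorem picardIterate_eq (hP : IsSymmSubMarkovSemigroup m P) {α : ℝ} (hα : 0 < α)
    (f : Lp ℝ 2 m) (n : ℕ) (t : ℝ) : picardIterate P α f n t =
      ∑ k ∈ Finset.range (n + 1),
        ((-t) ^ k / (k.factorial : ℝ)) • (hP.resolventCLM hα ^ (k + 1)) f := by
  induction n generalizing t with
  | zero => simp [picardIterate, resolventCLM_apply]
  | succ n ih =>
    rw [← picard_taylor_succ, picardIterate]
    simp only [ih, resolventCLM_apply]

theorem norm_picardIterate_sub_besselOp_le (hP : IsSymmSubMarkovSemigroup m P) {α : ℝ}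
    (hα : 0 < α) (f : Lp ℝ 2 m) (n : ℕ) {s t : ℝ} (hs : s ∈ Set.Icc 0 t) :
    ‖picardIterate P α f n s - besselOp P α s f‖
      ≤ t ^ n / (α ^ (n + 1) * (n.factorial : ℝ)) * ‖f‖ := by
  obtain ⟨hs0, hst⟩ := hs
  rw [hP.picardIterate_eq hα, hP.besselOp_eq hα hs0]
  calc _ ≤ α⁻¹ ^ (n + 1) * ‖f‖ * (s ^ n / (n.factorial : ℝ)) :=
        norm_taylor_sub_exp_le (hP.resolventCLM_symm hα) (hP.resolventCLM_nonneg hα)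
          (inv_nonneg.2 hα.le) (hP.norm_resolventOp_le hα) f n hs0
    _ ≤ α⁻¹ ^ (n + 1) * ‖f‖ * (t ^ n / (n.factorial : ℝ)) := by gcongr
    _ = _ := by
        rw [inv_pow]
        field_simp

end IsSymmSubMarkovSemigroup

/-! ### Existence of the integrals and uniform convergence. -/

theorem mainTheorem8 {E : Type*} [MetricSpace E] [LocallyCompactSpace E]
    [TopologicalSpace.SeparableSpace E] [MeasurableSpace E] [BorelSpace E]
    (m : Measure E) [SigmaFinite m] [m.IsOpenPosMeasure]
    (P : ℝ → Lp ℝ 2 m →L[ℝ] Lp ℝ 2 m) (hP : IsSymmSubMarkovSemigroup m P)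
    (α : ℝ) (hα : 0 < α) (f : Lp ℝ 2 m) :
    -- the Bochner integrals that define `U^α`, `𝒥^α_t f` and the iterates exist
    (∀ g : Lp ℝ 2 m,
      IntegrableOn (fun s : ℝ => Real.exp (-α * s) • P s g) (Set.Ioi 0) volume) ∧
    (∀ t : ℝ, 0 ≤ t → IntegrableOn
      (fun s : ℝ => (besselJZero (2 * Real.sqrt (t * s)) * Real.exp (-α * s)) • P s f)
      (Set.Ioi 0) volume) ∧
    (∀ (n : ℕ) (t : ℝ), 0 ≤ t → IntervalIntegrable
      (fun s : ℝ => resolventOp P α (picardIterate P α f n s)) volume 0 t) ∧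
    -- uniform convergence on `[0, t]` in `L²(m)`, and the error bound
    (∀ t : ℝ, 0 < t →
      TendstoUniformlyOn (picardIterate P α f) (fun s : ℝ => besselOp P α s f) atTop
        (Set.Icc 0 t) ∧
      ∀ n : ℕ, ∀ s ∈ Set.Icc (0 : ℝ) t,
        ‖picardIterate P α f n s - besselOp P α s f‖
          ≤ t ^ n / (α ^ (n + 1) * (n.factorial : ℝ)) * ‖f‖) := by
  refine ⟨hP.integrableOn_exp_smul_apply hα,
    fun t ht => (hP.integrableOn_and_hasSum_besselOp hα ht f).1, fun n t _ => ?_,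
    fun t _ => ⟨?_, fun n s hs => hP.norm_picardIterate_sub_besselOp_le hα f n hs⟩⟩
  · simp only [← hP.resolventCLM_apply hα, hP.picardIterate_eq hα]
    exact Continuous.intervalIntegrable (by fun_prop) _ _
  · have hlim : Tendsto (fun n : ℕ => t ^ n / (α ^ (n + 1) * (n.factorial : ℝ)) * ‖f‖) atTop
        (𝓝 0) := by
      have h := (FloorSemiring.tendsto_pow_div_factorial_atTop (t / α)).mul_const (α⁻¹ * ‖f‖)
      rw [zero_mul] at h
      refine h.congr fun n => ?_
      rw [div_pow, pow_succ]
      field_simp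
    rw [Metric.tendstoUniformlyOn_iff]
    intro ε hε
    filter_upwards [hlim.eventually_lt_const hε] with n hn s hs
    rw [dist_comm, dist_eq_norm]
    exact (hP.norm_picardIterate_sub_besselOp_le hα f n hs).trans_lt hn
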